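/- Let $(\mathcal X,\mathcal F)$ be a measurable space with a measure $\mu$, let $\mathcal M_\mu$ be the set of probability distributions on $\mathcal X$ that admit a density with respect to $\mu$ (distributions are written $P$ and their densities $p$), let $P_1,P_2\in\mathcal M_\mu$ with $P_1\neq P_2$, and let $\lambda_1,\lambda_2>0$. For $z=(z_0,z_1,z_2)\in\mathbb R_+^3$, where $\mathbb R_+=[0,\infty)$, put $g_\lambda(z)=\min\{\lambda_1z_1,\lambda_2z_2\}$, $\rho_\lambda^{(0)}=g_\lambda$ and, for $n\ge 1$, $$\rho_\lambda^{(n)}(z)=\min\Bigl\{g_\lambda(z),\; z_0+\sup_{P_0\in\mathcal M_\mu}\int_{\mathcal X}\rho_\lambda^{(n-1)}\bigl(z_0p_0(x),z_1p_1(x),z_2p_2(x)\bigr)\,\mu(\mathrm dx)\Bigr\}.$$ Then these integrals and suprema are well defined and finite, and the pointwise limit $\rho_\lambda=\lim_{n\to\infty}\rho_\lambda^{(n)}$ exists on $\mathbb R_+^3$. Let $\partial_{z_0}^+$ denote the right derivative with respect to $z_0$, i.e. the limit, possibly $+\infty$, of the right difference quotients. For all $n\in\mathbb N_0$: 1. $\rho_\lambda^{(n)}$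 and $\rho_\lambda$ are nondecreasing (for the componentwise order) and concave on $\mathbb R_+^3$. 2. For all $z\in\mathbb R_+^3$ the right derivatives below exist and $\partial_{z_0}^+\rho_\lambda^{(n)}(z)\in\{0,\dots,n\}$, $\partial_{z_0}^+\rho_\lambda(z)\in\mathbb N_0\cup\{\infty\}$. Moreover, for all $(z_1,z_2)\in\mathbb R_+^2$, $\rho_\lambda(0,z_1,z_2)=0$ and, provided that $P_1$ and $P_2$ are not mutually singular, $\partial_{z_0}^+\rho_\lambda(0,z_1,z_2)\in\{0,\infty\}$. -/

import Mathlib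

open MeasureTheory Filter Topology

/-- `p` is a probability density with respect to `μ` (a real-valued version of it). -/
structure IsDensity {X : Type*} [MeasurableSpace X] (μ : Measure X) (p : X → ℝ) : Prop where
  measurable : Measurable p
  nonneg : ∀ x, 0 ≤ p x
  integrable : Integrable p μ
  integral_eq_one : ∫ x, p x ∂μ = 1

/-- The distribution with density `p` with respect to `μ`. -/
noncomputable def densityMeasure {X : Type*} [MeasurableSpace X] (μ : Measure X) (p : X → ℝ) :
    Measure X :=
  μ.withDensity (fun x => ENNReal.ofReal (p x))

/-- The nonnegative orthant of `ℝ³`; points are written `z = (z₀, z₁, z₂)`. -/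
def orthant : Set (ℝ × ℝ × ℝ) := {z | 0 ≤ z.1 ∧ 0 ≤ z.2.1 ∧ 0 ≤ z.2.2}

/-- The stopping cost `g_λ(z) = min {λ₁ z₁, λ₂ z₂}`. -/
noncomputable def stopCost (l₁ l₂ : ℝ) (z : ℝ × ℝ × ℝ) : ℝ := min (l₁ * z.2.1) (l₂ * z.2.2)

/-- `∫ ρ(z₀ p₀(x), z₁ p₁(x), z₂ p₂(x)) μ(dx)`, the quantity that is maximized over `p₀`. -/
noncomputable def expectedCost {X : Type*} [MeasurableSpace X] (μ : Measure X) (p₁ p₂ : X → ℝ)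
    (ρ : ℝ × ℝ × ℝ → ℝ) (z : ℝ × ℝ × ℝ) (p₀ : X → ℝ) : ℝ :=
  ∫ x, ρ (z.1 * p₀ x, z.2.1 * p₁ x, z.2.2 * p₂ x) ∂μ

/-- The supremum of `expectedCost` over all distributions with a density `p₀` w.r.t. `μ`. -/
noncomputable def continueCost {X : Type*} [MeasurableSpace X] (μ : Measure X) (p₁ p₂ : X → ℝ)
    (ρ : ℝ × ℝ × ℝ → ℝ) (z : ℝ × ℝ × ℝ) : ℝ :=
  sSup (expectedCost μ p₁ p₂ ρ z '' {p₀ | IsDensity μ p₀})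

/-- The finite-horizon cost functions `ρ_λ^(n)`. -/
noncomputable def rhoN {X : Type*} [MeasurableSpace X] (μ : Measure X) (p₁ p₂ : X → ℝ)
    (l₁ l₂ : ℝ) : ℕ → ℝ × ℝ × ℝ → ℝ
  | 0 => stopCost l₁ l₂
  | n + 1 => fun z =>
      min (stopCost l₁ l₂ z) (z.1 + continueCost μ p₁ p₂ (rhoN μ p₁ p₂ l₁ l₂ n) z)

/-- The limit cost function `ρ_λ = lim ρ_λ^(n)` (pointwise). -/
noncomputable def rhoLim {X : Type*} [MeasurableSpace X] (μ : Measure X) (p₁ p₂ : X → ℝ)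
    (l₁ l₂ : ℝ) (z : ℝ × ℝ × ℝ) : ℝ :=
  limUnder atTop (fun n : ℕ => rhoN μ p₁ p₂ l₁ l₂ n z)

/-- `f` has the (possibly infinite) right derivative `c` at `x`. -/
def HasRightDeriv (f : ℝ → ℝ) (c : EReal) (x : ℝ) : Prop :=
  Tendsto (fun t : ℝ => (((f t - f x) / (t - x) : ℝ) : EReal)) (𝓝[>] x) (𝓝 c)

/-!
The finite-horizon costs `rhoN n` are Lipschitz on `ℝ³` with constants `n`, `l₁`, `l₂` in the three
coordinates, because integrating against densities preserves such bounds
(`isLipschitzCost_rhoN`); this gives continuity, integrability and finiteness of the suprema.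
Monotonicity passes through the recursion pointwise, and concavity because the mass distributions
`z₀ p₀` over which the supremum is taken can be mixed (`concaveOn_continueCost`). As `rhoN n`
decreases in `n` and is nonnegative on the orthant, the limit exists and inherits both properties.

The integrality of the right derivatives rests on the fact that `t ↦ rhoN n (t, z₁, z₂)` has at
each point a supergradient in `{0, …, n}`. In the recursion, the mass `s = z₀` is distributed over
the points `x` so as to maximize `∫ h x (v x)`, where each `h x` is piecewise affine with integer
slopes. The point from which on `h x` has slope at most `k` is a measurable function of `x`, and
interpolating between these thresholds for two consecutive slopes produces a `v` of mass `s` along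
which all `h x` have the same integer supergradient (`exists_common_supergradient`). That integer
is then a supergradient of the optimal value, and adding `z₀` raises it by one. Right derivatives
of concave limits of such functions are natural numbers or infinite (`rightDeriv_nat_or_top`).

At `z₀ = 0` the recursion contracts by the Bhattacharyya coefficient `∫ √(p₁ p₂) < 1`, relative to
`√(z₁ z₂)`, so the limit vanishes there. If the two distributions are not mutually singular, the
choice of `p₀` proportional to `min {p₁, p₂}` shows that near `z₀ = 0` the costs exceed every
multiple of `z₀` uniformly in `n` (`exists_mul_min_le_rhoN`) when `z₁, z₂ > 0`, so that the right
derivative is infinite; if `z₁ = 0` or `z₂ = 0`, the cost vanishes identically.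
-/

/-! ### Right derivatives of limits of functions with integer supergradients -/

/-- `f` has at every `s ≥ 0` a supergradient (on the half-line `[0, ∞)`) which is a natural number
not exceeding `N`. For concave `f` this says that `f` is piecewise affine with slopes in
`{0, …, N}`. -/
def HasNatSupergradients (N : ℕ) (f : ℝ → ℝ) : Prop :=
  ∀ s, 0 ≤ s → ∃ m : ℕ, m ≤ N ∧ ∀ u, 0 ≤ u → f u ≤ f s + m * (u - s)

lemma ConcaveOn.exists_hasRightDeriv {f : ℝ → ℝ} (hf : ConcaveOn ℝ (Set.Ici 0) f) {t : ℝ}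
    (ht : 0 ≤ t) :
    ∃ d : EReal, HasRightDeriv f d t ∧ ∀ s, t < s → (((f s - f t) / (s - t) : ℝ) : EReal) ≤ d := by
  have hanti : AntitoneOn (fun s : ℝ => (((f s - f t) / (s - t) : ℝ) : EReal)) (Set.Ioi t) := by
    intro a ha b hb hab
    have ha' : t < a := ha
    have hb' : t < b := hb
    have h := hf.slope_anti (x := t) ht
      (show a ∈ Set.Ici 0 \ {t} from ⟨ht.trans ha'.le, ha'.ne'⟩)
      (show b ∈ Set.Ici 0 \ {t} from ⟨ht.trans hb'.le, hb'.ne'⟩) hab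
    simp only [slope_def_field] at h
    exact EReal.coe_le_coe_iff.2 h
  refine ⟨_, hanti.tendsto_nhdsGT (OrderTop.bddAbove _), fun s hs => ?_⟩
  exact le_sSup (Set.mem_image_of_mem _ hs)

/-- If the right derivative at `t` were strictly between `k` and `k + 1`, then so would be the
slopes of `f` over two adjacent short intervals to the right of `t`, hence also those of an
approximating function, which has an integer supergradient at their common endpoint. -/
theorem rightDeriv_nat_or_top {f : ℝ → ℝ} {F : ℕ → ℝ → ℝ} (hconc : ConcaveOn ℝ (Set.Ici 0) f)
    (hmono : MonotoneOn f (Set.Ici 0))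
    (hlim : ∀ s, 0 ≤ s → Tendsto (fun n => F n s) atTop (𝓝 (f s)))
    {N : ℕ → ℕ} (hF : ∀ n, HasNatSupergradients (N n) (F n)) {t : ℝ} (ht : 0 ≤ t) :
    (∃ k : ℕ, HasRightDeriv f (k : EReal) t) ∨ HasRightDeriv f ⊤ t := by
  obtain ⟨d, hd, hle⟩ := hconc.exists_hasRightDeriv ht
  have hd0 : 0 ≤ d := by
    refine le_trans ?_ (hle (t + 1) (by linarith))
    have : f t ≤ f (t + 1) := hmono ht (show (0:ℝ) ≤ t + 1 by linarith) (by linarith)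
    have h2 : (0:ℝ) ≤ (f (t + 1) - f t) / (t + 1 - t) :=
      div_nonneg (by linarith) (by linarith)
    exact_mod_cast h2
  induction d with
  | bot => simp at hd0
  | top => exact Or.inr hd
  | coe r =>
    left
    have hr : 0 ≤ r := by exact_mod_cast hd0
    set k := ⌊r⌋₊ with hk
    rcases (Nat.floor_le hr).eq_or_lt with h | hkr
    · refine ⟨k, ?_⟩
      rw [← h] at hd
      exact_mod_cast hd
    exfalso
    have hrk : r < k + 1 := Nat.lt_floor_add_one r
    -- a point `b` such that the slope over `[t, b]` exceeds `k`
    have hev : ∀ᶠ s in 𝓝[>] t, ((k : ℝ) : EReal) < (((f s - f t) / (s - t) : ℝ) : EReal) :=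
      hd.eventually (lt_mem_nhds (EReal.coe_lt_coe_iff.2 hkr))
    obtain ⟨b, hb, htb⟩ := (hev.and self_mem_nhdsWithin).exists
    have htb : t < b := htb
    have hb : (k : ℝ) * (b - t) < f b - f t := by
      rw [EReal.coe_lt_coe_iff, lt_div_iff₀ (by linarith)] at hb
      exact hb
    obtain ⟨η, hη0, hη1, hη2⟩ : ∃ η : ℝ, 0 < η ∧ η < b - t ∧ η < f b - f t - k * (b - t) := by
      obtain ⟨η, h1, h2⟩ := exists_between
        (show (0 : ℝ) < min (b - t) (f b - f t - k * (b - t)) from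
          lt_min (by linarith) (by linarith))
      exact ⟨η, h1, lt_of_lt_of_le h2 (min_le_left _ _), lt_of_lt_of_le h2 (min_le_right _ _)⟩
    have ha : f (t + η) - f t ≤ r * η := by
      have h := hle (t + η) (by linarith)
      rw [EReal.coe_le_coe_iff, add_sub_cancel_left, div_le_iff₀ hη0] at h
      exact h
    have hrη : (r - k) * η < 1 * η := mul_lt_mul_of_pos_right (by linarith) hη0
    have h1 : f (t + η) - f t < (k + 1) * η := by linarith
    have h2 : k * (b - (t + η)) < f b - f (t + η) := by linarith
    have e1 := ((hlim (t + η) (by linarith)).sub (hlim t ht)).eventually (gt_mem_nhds h1)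
    have e2 := ((hlim b (by linarith)).sub (hlim (t + η) (by linarith))).eventually
      (lt_mem_nhds h2)
    obtain ⟨n, g1, g2⟩ := (e1.and e2).exists
    obtain ⟨m, -, hm⟩ := hF n (t + η) (by linarith)
    have m1 := hm b (by linarith)
    have m2 := hm t ht
    have k1 : (k : ℝ) < m := by
      by_contra hcon
      have := mul_le_mul_of_nonneg_right (not_lt.1 hcon) (show 0 ≤ b - (t + η) by linarith)
      linarith
    have k2 : (m : ℝ) < k + 1 := by
      by_contra hcon
      have := mul_le_mul_of_nonneg_right (not_lt.1 hcon) hη0.le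
      linarith
    have k1' : k < m := by exact_mod_cast k1
    have k2' : m < k + 1 := by exact_mod_cast k2
    omega

theorem HasNatSupergradients.exists_hasRightDeriv {f : ℝ → ℝ} {N : ℕ}
    (hF : HasNatSupergradients N f) (hconc : ConcaveOn ℝ (Set.Ici 0) f)
    (hmono : MonotoneOn f (Set.Ici 0)) {t : ℝ} (ht : 0 ≤ t) :
    ∃ k : ℕ, k ≤ N ∧ HasRightDeriv f (k : EReal) t := by
  have key : ∀ c : EReal, HasRightDeriv f c t → c ≤ ((N : ℝ) : EReal) := by
    intro c hc
    refine le_of_tendsto hc ?_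
    filter_upwards [self_mem_nhdsWithin] with s hs
    have hs : t < s := hs
    obtain ⟨m, hmN, hm⟩ := hF t ht
    rw [EReal.coe_le_coe_iff, div_le_iff₀ (by linarith)]
    have h1 := hm s (by linarith)
    have h2 : (m : ℝ) * (s - t) ≤ N * (s - t) :=
      mul_le_mul_of_nonneg_right (by exact_mod_cast hmN) (by linarith)
    linarith
  rcases rightDeriv_nat_or_top (F := fun _ => f) hconc hmono (fun _ _ => tendsto_const_nhds)
    (fun _ => hF) ht with ⟨k, hk⟩ | htop
  · refine ⟨k, ?_, hk⟩
    have := key _ hk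
    exact_mod_cast this
  · exact absurd (key _ htop) (not_le.2 (EReal.coe_lt_top _))

section

variable {X : Type*} [MeasurableSpace X] {μ : Measure X} {p₁ p₂ : X → ℝ} {l₁ l₂ a : ℝ}
  {ρ : ℝ × ℝ × ℝ → ℝ}

/-! ### Lipschitz continuity, integrability and boundedness -/

/-- `ρ` vanishes at the origin and is Lipschitz on all of `ℝ³`, with constants `a`, `l₁`, `l₂` in
the three coordinates. Since densities integrate to `1`, integration against densities preserves
the constants, so that they can be tracked through the recursion. -/
structure IsLipschitzCost (a l₁ l₂ : ℝ) (ρ : ℝ × ℝ × ℝ → ℝ) : Prop where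
  zero : ρ 0 = 0
  abs_sub_le : ∀ z w : ℝ × ℝ × ℝ,
    |ρ z - ρ w| ≤ a * |z.1 - w.1| + l₁ * |z.2.1 - w.2.1| + l₂ * |z.2.2 - w.2.2|

lemma IsLipschitzCost.continuous (h : IsLipschitzCost a l₁ l₂ ρ) : Continuous ρ := by
  rw [continuous_iff_continuousAt]
  intro w
  have hb : Tendsto (fun z : ℝ × ℝ × ℝ =>
      a * |z.1 - w.1| + l₁ * |z.2.1 - w.2.1| + l₂ * |z.2.2 - w.2.2|) (𝓝 w) (𝓝 0) := by
    have : Continuous (fun z : ℝ × ℝ × ℝ =>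
      a * |z.1 - w.1| + l₁ * |z.2.1 - w.2.1| + l₂ * |z.2.2 - w.2.2|) := by fun_prop
    simpa using this.tendsto w
  refine tendsto_iff_dist_tendsto_zero.2 (squeeze_zero (fun _ => dist_nonneg) (fun z => ?_) hb)
  rw [Real.dist_eq]
  exact h.abs_sub_le z w

lemma IsLipschitzCost.integrable_comp (h : IsLipschitzCost a l₁ l₂ ρ) (hp₁ : IsDensity μ p₁)
    (hp₂ : IsDensity μ p₂) {v : X → ℝ} (hvm : Measurable v) (hv : Integrable v μ) (y₁ y₂ : ℝ) :
    Integrable (fun x => ρ (v x, y₁ * p₁ x, y₂ * p₂ x)) μ := by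
  have hm₁ := hp₁.measurable
  have hm₂ := hp₂.measurable
  have hb : Integrable (fun x => a * |v x| + l₁ * |y₁ * p₁ x| + l₂ * |y₂ * p₂ x|) μ :=
    ((hv.abs.const_mul a).add ((hp₁.integrable.const_mul y₁).abs.const_mul l₁)).add
      ((hp₂.integrable.const_mul y₂).abs.const_mul l₂)
  refine hb.mono' ?_ (Eventually.of_forall fun x => ?_)
  · exact (h.continuous.measurable.comp (by fun_prop)).aestronglyMeasurable
  · have := h.abs_sub_le (v x, y₁ * p₁ x, y₂ * p₂ x) 0
    simpa [h.zero] using this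

lemma IsLipschitzCost.integrable (h : IsLipschitzCost a l₁ l₂ ρ) (hp₁ : IsDensity μ p₁)
    (hp₂ : IsDensity μ p₂) {p₀ : X → ℝ} (hp₀ : IsDensity μ p₀) (z : ℝ × ℝ × ℝ) :
    Integrable (fun x => ρ (z.1 * p₀ x, z.2.1 * p₁ x, z.2.2 * p₂ x)) μ :=
  h.integrable_comp hp₁ hp₂ (hp₀.measurable.const_mul _) (hp₀.integrable.const_mul _) _ _

lemma IsLipschitzCost.expectedCost_sub_le (h : IsLipschitzCost a l₁ l₂ ρ) (hp₁ : IsDensity μ p₁)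
    (hp₂ : IsDensity μ p₂) {p₀ : X → ℝ} (hp₀ : IsDensity μ p₀) (z w : ℝ × ℝ × ℝ) :
    expectedCost μ p₁ p₂ ρ z p₀ - expectedCost μ p₁ p₂ ρ w p₀ ≤
      a * |z.1 - w.1| + l₁ * |z.2.1 - w.2.1| + l₂ * |z.2.2 - w.2.2| := by
  have e : ∫ x, (a * |z.1 - w.1| * p₀ x + l₁ * |z.2.1 - w.2.1| * p₁ x
      + l₂ * |z.2.2 - w.2.2| * p₂ x) ∂μ =
      a * |z.1 - w.1| + l₁ * |z.2.1 - w.2.1| + l₂ * |z.2.2 - w.2.2| := by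
    have i : Integrable (fun x => a * |z.1 - w.1| * p₀ x + l₁ * |z.2.1 - w.2.1| * p₁ x) μ :=
      (hp₀.integrable.const_mul _).add (hp₁.integrable.const_mul _)
    rw [integral_add i (hp₂.integrable.const_mul _), integral_add (hp₀.integrable.const_mul _)
      (hp₁.integrable.const_mul _), integral_const_mul, integral_const_mul, integral_const_mul,
      hp₀.integral_eq_one, hp₁.integral_eq_one, hp₂.integral_eq_one, mul_one, mul_one, mul_one]
  rw [← e, expectedCost, expectedCost,
    ← integral_sub (h.integrable hp₁ hp₂ hp₀ z) (h.integrable hp₁ hp₂ hp₀ w)]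
  refine integral_mono ((h.integrable hp₁ hp₂ hp₀ z).sub (h.integrable hp₁ hp₂ hp₀ w))
    (((hp₀.integrable.const_mul _).add (hp₁.integrable.const_mul _)).add
      (hp₂.integrable.const_mul _)) fun x => ?_
  refine (le_abs_self _).trans ((h.abs_sub_le _ _).trans (le_of_eq ?_))
  simp only [← sub_mul, abs_mul, abs_of_nonneg (hp₀.nonneg x), abs_of_nonneg (hp₁.nonneg x),
    abs_of_nonneg (hp₂.nonneg x)]
  ring

lemma IsLipschitzCost.expectedCost_zero (h : IsLipschitzCost a l₁ l₂ ρ) (p₀ : X → ℝ) :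
    expectedCost μ p₁ p₂ ρ 0 p₀ = 0 := by
  have h0 : ρ (0, 0, 0) = 0 := h.zero
  simp [expectedCost, h0]

lemma IsLipschitzCost.bddAbove (h : IsLipschitzCost a l₁ l₂ ρ) (hp₁ : IsDensity μ p₁)
    (hp₂ : IsDensity μ p₂) (z : ℝ × ℝ × ℝ) :
    BddAbove (expectedCost μ p₁ p₂ ρ z '' {p₀ | IsDensity μ p₀}) := by
  refine ⟨a * |z.1| + l₁ * |z.2.1| + l₂ * |z.2.2|, ?_⟩
  rintro _ ⟨p₀, hp₀, rfl⟩
  have := h.expectedCost_sub_le hp₁ hp₂ hp₀ z 0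
  simpa [h.expectedCost_zero] using this

lemma IsLipschitzCost.le_continueCost (h : IsLipschitzCost a l₁ l₂ ρ) (hp₁ : IsDensity μ p₁)
    (hp₂ : IsDensity μ p₂) {p₀ : X → ℝ} (hp₀ : IsDensity μ p₀) (z : ℝ × ℝ × ℝ) :
    expectedCost μ p₁ p₂ ρ z p₀ ≤ continueCost μ p₁ p₂ ρ z :=
  le_csSup (h.bddAbove hp₁ hp₂ z) (Set.mem_image_of_mem _ hp₀)

lemma continueCost_le (hp₁ : IsDensity μ p₁) {z : ℝ × ℝ × ℝ} {c : ℝ}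
    (hc : ∀ p₀, IsDensity μ p₀ → expectedCost μ p₁ p₂ ρ z p₀ ≤ c) :
    continueCost μ p₁ p₂ ρ z ≤ c := by
  refine csSup_le (Set.Nonempty.image _ ⟨p₁, hp₁⟩) ?_
  rintro _ ⟨p₀, hp₀, rfl⟩
  exact hc p₀ hp₀

lemma IsLipschitzCost.continueCost_sub_le (h : IsLipschitzCost a l₁ l₂ ρ) (hp₁ : IsDensity μ p₁)
    (hp₂ : IsDensity μ p₂) (z w : ℝ × ℝ × ℝ) :
    continueCost μ p₁ p₂ ρ z - continueCost μ p₁ p₂ ρ w ≤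
      a * |z.1 - w.1| + l₁ * |z.2.1 - w.2.1| + l₂ * |z.2.2 - w.2.2| := by
  rw [sub_le_iff_le_add]
  refine continueCost_le hp₁ fun p₀ hp₀ => ?_
  have h1 := h.expectedCost_sub_le hp₁ hp₂ hp₀ z w
  have h2 := h.le_continueCost hp₁ hp₂ hp₀ w
  linarith

lemma stopCost_sub_le (hl₁ : 0 ≤ l₁) (hl₂ : 0 ≤ l₂) (z w : ℝ × ℝ × ℝ) :
    stopCost l₁ l₂ z - stopCost l₁ l₂ w ≤ l₁ * |z.2.1 - w.2.1| + l₂ * |z.2.2 - w.2.2| := by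
  have h1 := mul_le_mul_of_nonneg_left (le_abs_self (z.2.1 - w.2.1)) hl₁
  have h2 := mul_le_mul_of_nonneg_left (le_abs_self (z.2.2 - w.2.2)) hl₂
  have h3 := mul_nonneg hl₁ (abs_nonneg (z.2.1 - w.2.1))
  have h4 := mul_nonneg hl₂ (abs_nonneg (z.2.2 - w.2.2))
  rw [sub_le_iff_le_add, stopCost, stopCost]
  rcases min_choice (l₁ * w.2.1) (l₂ * w.2.2) with h | h <;> rw [h]
  · exact (min_le_left _ _).trans (by linarith)
  · exact (min_le_right _ _).trans (by linarith)

/-- One step of the recursion raises only the Lipschitz constant of the coordinate `z₀`, by `1`. -/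
lemma IsLipschitzCost.step (h : IsLipschitzCost a l₁ l₂ ρ) (ha : 0 ≤ a) (hl₁ : 0 ≤ l₁)
    (hl₂ : 0 ≤ l₂) (hp₁ : IsDensity μ p₁) (hp₂ : IsDensity μ p₂) :
    IsLipschitzCost (a + 1) l₁ l₂
      (fun z => min (stopCost l₁ l₂ z) (z.1 + continueCost μ p₁ p₂ ρ z)) := by
  have key : ∀ z w : ℝ × ℝ × ℝ, min (stopCost l₁ l₂ z) (z.1 + continueCost μ p₁ p₂ ρ z)
      - min (stopCost l₁ l₂ w) (w.1 + continueCost μ p₁ p₂ ρ w) ≤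
      (a + 1) * |z.1 - w.1| + l₁ * |z.2.1 - w.2.1| + l₂ * |z.2.2 - w.2.2| := by
    intro z w
    have h1 := stopCost_sub_le hl₁ hl₂ z w
    have h2 := h.continueCost_sub_le hp₁ hp₂ z w
    have h3 := le_abs_self (z.1 - w.1)
    have h4 := mul_nonneg (add_nonneg ha zero_le_one) (abs_nonneg (z.1 - w.1))
    rw [sub_le_iff_le_add]
    rcases min_choice (stopCost l₁ l₂ w) (w.1 + continueCost μ p₁ p₂ ρ w) with h' | h' <;> rw [h']
    · exact (min_le_left _ _).trans (by linarith)
    · exact (min_le_right _ _).trans (by linarith)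
  constructor
  · have : continueCost μ p₁ p₂ ρ 0 = 0 :=
      le_antisymm (continueCost_le hp₁ fun p₀ _ => (h.expectedCost_zero p₀).le)
        ((h.expectedCost_zero p₁).ge.trans (h.le_continueCost hp₁ hp₂ hp₁ 0))
    simp [this, stopCost]
  · intro z w
    rw [abs_sub_le_iff]
    refine ⟨key z w, (key w z).trans (le_of_eq ?_)⟩
    rw [abs_sub_comm z.1, abs_sub_comm z.2.1, abs_sub_comm z.2.2]

lemma isLipschitzCost_rhoN (hp₁ : IsDensity μ p₁) (hp₂ : IsDensity μ p₂) (hl₁ : 0 ≤ l₁)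
    (hl₂ : 0 ≤ l₂) (n : ℕ) : IsLipschitzCost n l₁ l₂ (rhoN μ p₁ p₂ l₁ l₂ n) := by
  induction n with
  | zero =>
    refine ⟨by simp [rhoN, stopCost], fun z w => ?_⟩
    rw [abs_sub_le_iff]
    constructor
    · simpa [rhoN] using stopCost_sub_le hl₁ hl₂ z w
    · simpa [rhoN, abs_sub_comm z.2.1, abs_sub_comm z.2.2] using stopCost_sub_le hl₁ hl₂ w z
  | succ n ih =>
    rw [Nat.cast_succ]
    exact ih.step (Nat.cast_nonneg n) hl₁ hl₂ hp₁ hp₂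

/-! ### Monotonicity and concavity of the finite-horizon costs -/

lemma IsDensity.mem_orthant {p₀ : X → ℝ} (hp₀ : IsDensity μ p₀) (hp₁ : IsDensity μ p₁)
    (hp₂ : IsDensity μ p₂) {z : ℝ × ℝ × ℝ} (hz : z ∈ orthant) (x : X) :
    (z.1 * p₀ x, z.2.1 * p₁ x, z.2.2 * p₂ x) ∈ orthant :=
  ⟨mul_nonneg hz.1 (hp₀.nonneg x), mul_nonneg hz.2.1 (hp₁.nonneg x),
    mul_nonneg hz.2.2 (hp₂.nonneg x)⟩

lemma continueCost_mono {b : ℝ} {σ : ℝ × ℝ × ℝ → ℝ} (hρ : IsLipschitzCost a l₁ l₂ ρ)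
    (hσ : IsLipschitzCost b l₁ l₂ σ) (hp₁ : IsDensity μ p₁) (hp₂ : IsDensity μ p₂)
    (hle : ∀ z ∈ orthant, ρ z ≤ σ z) {z : ℝ × ℝ × ℝ} (hz : z ∈ orthant) :
    continueCost μ p₁ p₂ ρ z ≤ continueCost μ p₁ p₂ σ z :=
  continueCost_le hp₁ fun _ hp₀ =>
    (integral_mono (hρ.integrable hp₁ hp₂ hp₀ z) (hσ.integrable hp₁ hp₂ hp₀ z)
      fun x => hle _ (hp₀.mem_orthant hp₁ hp₂ hz x)).trans (hσ.le_continueCost hp₁ hp₂ hp₀ z)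

lemma monotoneOn_continueCost (h : IsLipschitzCost a l₁ l₂ ρ) (hp₁ : IsDensity μ p₁)
    (hp₂ : IsDensity μ p₂) (hmono : MonotoneOn ρ orthant) :
    MonotoneOn (continueCost μ p₁ p₂ ρ) orthant := by
  intro z hz w hw hzw
  refine continueCost_le hp₁ fun p₀ hp₀ => ?_
  refine le_trans ?_ (h.le_continueCost hp₁ hp₂ hp₀ w)
  refine integral_mono (h.integrable hp₁ hp₂ hp₀ z) (h.integrable hp₁ hp₂ hp₀ w) fun x => ?_
  exact hmono (hp₀.mem_orthant hp₁ hp₂ hz x) (hp₀.mem_orthant hp₁ hp₂ hw x)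
    ⟨mul_le_mul_of_nonneg_right hzw.1 (hp₀.nonneg x),
      mul_le_mul_of_nonneg_right hzw.2.1 (hp₁.nonneg x),
      mul_le_mul_of_nonneg_right hzw.2.2 (hp₂.nonneg x)⟩

lemma convex_orthant : Convex ℝ orthant := by
  rintro z ⟨h1, h2, h3⟩ w ⟨h4, h5, h6⟩ s t hs ht -
  refine ⟨?_, ?_, ?_⟩ <;> simp only [Prod.fst_add, Prod.snd_add, Prod.smul_fst, Prod.smul_snd,
    smul_eq_mul] <;> positivity

lemma monotoneOn_stopCost (hl₁ : 0 ≤ l₁) (hl₂ : 0 ≤ l₂) (s : Set (ℝ × ℝ × ℝ)) :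
    MonotoneOn (stopCost l₁ l₂) s := fun _ _ _ _ h =>
  min_le_min (mul_le_mul_of_nonneg_left h.2.1 hl₁) (mul_le_mul_of_nonneg_left h.2.2 hl₂)

lemma concaveOn_stopCost : ConcaveOn ℝ orthant (stopCost l₁ l₂) := by
  have h₁ : ConcaveOn ℝ orthant (fun z : ℝ × ℝ × ℝ => l₁ * z.2.1) := by
    refine ⟨convex_orthant, fun z _ w _ s t _ _ _ => le_of_eq ?_⟩
    simp only [Prod.fst_add, Prod.snd_add, Prod.smul_fst, Prod.smul_snd, smul_eq_mul]; ring
  have h₂ : ConcaveOn ℝ orthant (fun z : ℝ × ℝ × ℝ => l₂ * z.2.2) := by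
    refine ⟨convex_orthant, fun z _ w _ s t _ _ _ => le_of_eq ?_⟩
    simp only [Prod.snd_add, Prod.smul_snd, smul_eq_mul]; ring
  exact h₁.inf h₂

/-- The supremum over densities `p₀` equals the supremum over nonnegative `v = z₀ p₀` of total
mass `z₀`, which does not degenerate at `z₀ = 0`. This is the inequality that has content. -/
lemma IsLipschitzCost.integral_le_continueCost (h : IsLipschitzCost a l₁ l₂ ρ)
    (hp₁ : IsDensity μ p₁) (hp₂ : IsDensity μ p₂) {v : X → ℝ} (hvm : Measurable v)
    (hv0 : ∀ x, 0 ≤ v x) (hv : Integrable v μ) (y₁ y₂ : ℝ) :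
    ∫ x, ρ (v x, y₁ * p₁ x, y₂ * p₂ x) ∂μ ≤ continueCost μ p₁ p₂ ρ (∫ x, v x ∂μ, y₁, y₂) := by
  rcases (integral_nonneg hv0 : 0 ≤ ∫ x, v x ∂μ).eq_or_lt with h0 | hpos
  · have hae : v =ᵐ[μ] 0 := (integral_eq_zero_iff_of_nonneg hv0 hv).1 h0.symm
    refine le_trans (le_of_eq ?_) (h.le_continueCost hp₁ hp₂ hp₁ _)
    refine integral_congr_ae ?_
    filter_upwards [hae] with x hx
    simp [hx, ← h0]
  · set c := ∫ x, v x ∂μ with hc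
    have hd : IsDensity μ (fun x => c⁻¹ * v x) :=
      ⟨hvm.const_mul _, fun x => mul_nonneg (inv_nonneg.2 hpos.le) (hv0 x), hv.const_mul _, by
        rw [integral_const_mul, ← hc, inv_mul_cancel₀ hpos.ne']⟩
    refine le_trans (le_of_eq ?_) (h.le_continueCost hp₁ hp₂ hd _)
    simp only [expectedCost, mul_inv_cancel_left₀ hpos.ne']

lemma concaveOn_continueCost (h : IsLipschitzCost a l₁ l₂ ρ) (hp₁ : IsDensity μ p₁)
    (hp₂ : IsDensity μ p₂) (hconc : ConcaveOn ℝ orthant ρ) :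
    ConcaveOn ℝ orthant (continueCost μ p₁ p₂ ρ) := by
  refine ⟨convex_orthant, fun z hz w hw s t hs ht hst => ?_⟩
  have hkey : ∀ p, IsDensity μ p → ∀ q, IsDensity μ q →
      s * expectedCost μ p₁ p₂ ρ z p + t * expectedCost μ p₁ p₂ ρ w q ≤
        continueCost μ p₁ p₂ ρ (s • z + t • w) := by
    intro p hp q hq
    have hz0 := hz.1
    have hw0 := hw.1
    -- the mixture of the two mass distributions `z₀ p` and `w₀ q`
    set v : X → ℝ := fun x => s * (z.1 * p x) + t * (w.1 * q x) with hv
    have hpm := hp.measurable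
    have hqm := hq.measurable
    have hi1 := (hp.integrable.const_mul z.1).const_mul s
    have hi2 := (hq.integrable.const_mul w.1).const_mul t
    have hvm : Measurable v := by fun_prop
    have hvi : Integrable v μ := hi1.add hi2
    have hv0 : ∀ x, 0 ≤ v x := fun x => by
      have := hp.nonneg x
      have := hq.nonneg x
      simp only [hv]
      positivity
    have hvint : ∫ x, v x ∂μ = s * z.1 + t * w.1 := by
      rw [hv, integral_add hi1 hi2, integral_const_mul, integral_const_mul, integral_const_mul,
        integral_const_mul, hp.integral_eq_one, hq.integral_eq_one, mul_one, mul_one]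
    have hmain := h.integral_le_continueCost hp₁ hp₂ hvm hv0 hvi (s * z.2.1 + t * w.2.1)
      (s * z.2.2 + t * w.2.2)
    rw [hvint] at hmain
    refine le_trans ?_ hmain
    have hz' := h.integrable hp₁ hp₂ hp z
    have hw' := h.integrable hp₁ hp₂ hq w
    rw [expectedCost, expectedCost, ← integral_const_mul, ← integral_const_mul,
      ← integral_add (hz'.const_mul s) (hw'.const_mul t)]
    refine integral_mono ((hz'.const_mul s).add (hw'.const_mul t))
      (h.integrable_comp hp₁ hp₂ hvm hvi _ _) fun x => ?_
    have := hconc.2 (hp.mem_orthant hp₁ hp₂ hz x) (hq.mem_orthant hp₁ hp₂ hw x) hs ht hst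
    refine le_trans this (le_of_eq (congrArg ρ ?_))
    simp only [hv, Prod.smul_mk, Prod.mk_add_mk, smul_eq_mul, Prod.mk.injEq, true_and]
    constructor <;> ring
  have hA : ∀ q, IsDensity μ q → s * continueCost μ p₁ p₂ ρ z + t * expectedCost μ p₁ p₂ ρ w q ≤
      continueCost μ p₁ p₂ ρ (s • z + t • w) := by
    intro q hq
    rcases hs.eq_or_lt with h0 | hs0
    · have := hkey p₁ hp₁ q hq
      rw [← h0] at this ⊢
      linarith
    · rw [← le_sub_iff_add_le, ← le_div_iff₀' hs0]
      refine continueCost_le hp₁ fun p hp => ?_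
      rw [le_div_iff₀' hs0, le_sub_iff_add_le]
      exact hkey p hp q hq
  simp only [smul_eq_mul]
  rcases ht.eq_or_lt with h0 | ht0
  · have := hA p₁ hp₁
    rw [← h0] at this ⊢
    linarith
  · rw [← le_sub_iff_add_le', ← le_div_iff₀' ht0]
    refine continueCost_le hp₁ fun q hq => ?_
    rw [le_div_iff₀' ht0, le_sub_iff_add_le']
    exact hA q hq

lemma monotoneOn_concaveOn_rhoN (hp₁ : IsDensity μ p₁) (hp₂ : IsDensity μ p₂) (hl₁ : 0 ≤ l₁)
    (hl₂ : 0 ≤ l₂) (n : ℕ) : MonotoneOn (rhoN μ p₁ p₂ l₁ l₂ n) orthant ∧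
      ConcaveOn ℝ orthant (rhoN μ p₁ p₂ l₁ l₂ n) := by
  induction n with
  | zero => exact ⟨monotoneOn_stopCost hl₁ hl₂ _, concaveOn_stopCost⟩
  | succ n ih =>
    have hL := isLipschitzCost_rhoN hp₁ hp₂ hl₁ hl₂ n
    constructor
    · intro z hz w hw hzw
      exact min_le_min (monotoneOn_stopCost hl₁ hl₂ _ hz hw hzw)
        (add_le_add hzw.1 (monotoneOn_continueCost hL hp₁ hp₂ ih.1 hz hw hzw))
    · have hfst : ConcaveOn ℝ orthant (fun z : ℝ × ℝ × ℝ => z.1) :=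
        ⟨convex_orthant, fun z _ w _ s t _ _ _ => le_of_eq (by simp)⟩
      exact concaveOn_stopCost.inf (hfst.add (concaveOn_continueCost hL hp₁ hp₂ ih.2))

lemma rhoN_le_stopCost (n : ℕ) (z : ℝ × ℝ × ℝ) :
    rhoN μ p₁ p₂ l₁ l₂ n z ≤ stopCost l₁ l₂ z := by
  cases n with
  | zero => exact le_rfl
  | succ n => exact min_le_left _ _

lemma rhoN_nonneg (hp₁ : IsDensity μ p₁) (hp₂ : IsDensity μ p₂) (hl₁ : 0 ≤ l₁)
    (hl₂ : 0 ≤ l₂) (n : ℕ) {z : ℝ × ℝ × ℝ} (hz : z ∈ orthant) :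
    0 ≤ rhoN μ p₁ p₂ l₁ l₂ n z := by
  have hL := isLipschitzCost_rhoN hp₁ hp₂ hl₁ hl₂ n
  rw [← hL.zero]
  exact (monotoneOn_concaveOn_rhoN hp₁ hp₂ hl₁ hl₂ n).1 ⟨le_rfl, le_rfl, le_rfl⟩ hz
    ⟨hz.1, hz.2.1, hz.2.2⟩

lemma rhoN_succ_le (hp₁ : IsDensity μ p₁) (hp₂ : IsDensity μ p₂) (hl₁ : 0 ≤ l₁)
    (hl₂ : 0 ≤ l₂) (n : ℕ) {z : ℝ × ℝ × ℝ} (hz : z ∈ orthant) :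
    rhoN μ p₁ p₂ l₁ l₂ (n + 1) z ≤ rhoN μ p₁ p₂ l₁ l₂ n z := by
  induction n generalizing z with
  | zero => exact rhoN_le_stopCost 1 z
  | succ n ih =>
    exact min_le_min le_rfl (add_le_add le_rfl
      (continueCost_mono (isLipschitzCost_rhoN hp₁ hp₂ hl₁ hl₂ (n + 1))
        (isLipschitzCost_rhoN hp₁ hp₂ hl₁ hl₂ n) hp₁ hp₂ (fun _ hw => ih hw) hz))

/-! ### The limit cost -/

lemma tendsto_rhoN (hp₁ : IsDensity μ p₁) (hp₂ : IsDensity μ p₂) (hl₁ : 0 ≤ l₁)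
    (hl₂ : 0 ≤ l₂) {z : ℝ × ℝ × ℝ} (hz : z ∈ orthant) :
    Tendsto (fun n : ℕ => rhoN μ p₁ p₂ l₁ l₂ n z) atTop (𝓝 (rhoLim μ p₁ p₂ l₁ l₂ z)) := by
  have h := tendsto_atTop_ciInf (f := fun n : ℕ => rhoN μ p₁ p₂ l₁ l₂ n z)
    (antitone_nat_of_succ_le fun n => rhoN_succ_le hp₁ hp₂ hl₁ hl₂ n hz)
    ⟨0, by rintro _ ⟨n, rfl⟩; exact rhoN_nonneg hp₁ hp₂ hl₁ hl₂ n hz⟩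
  exact tendsto_nhds_limUnder ⟨_, h⟩

lemma monotoneOn_rhoLim (hp₁ : IsDensity μ p₁) (hp₂ : IsDensity μ p₂) (hl₁ : 0 ≤ l₁)
    (hl₂ : 0 ≤ l₂) : MonotoneOn (rhoLim μ p₁ p₂ l₁ l₂) orthant := fun _ hz _ hw hzw =>
  le_of_tendsto_of_tendsto' (tendsto_rhoN hp₁ hp₂ hl₁ hl₂ hz) (tendsto_rhoN hp₁ hp₂ hl₁ hl₂ hw)
    fun n => (monotoneOn_concaveOn_rhoN hp₁ hp₂ hl₁ hl₂ n).1 hz hw hzw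

lemma concaveOn_rhoLim (hp₁ : IsDensity μ p₁) (hp₂ : IsDensity μ p₂) (hl₁ : 0 ≤ l₁)
    (hl₂ : 0 ≤ l₂) : ConcaveOn ℝ orthant (rhoLim μ p₁ p₂ l₁ l₂) := by
  refine ⟨convex_orthant, fun z hz w hw s t hs ht hst => ?_⟩
  have hmem := convex_orthant hz hw hs ht hst
  exact le_of_tendsto_of_tendsto'
    (((tendsto_rhoN hp₁ hp₂ hl₁ hl₂ hz).const_smul s).add
      ((tendsto_rhoN hp₁ hp₂ hl₁ hl₂ hw).const_smul t)) (tendsto_rhoN hp₁ hp₂ hl₁ hl₂ hmem)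
    fun n => (monotoneOn_concaveOn_rhoN hp₁ hp₂ hl₁ hl₂ n).2.2 hz hw hs ht hst

/-- Concavity and monotonicity on the orthant, restricted to a line in direction `z₀`. -/
lemma concaveOn_monotoneOn_section {f : ℝ × ℝ × ℝ → ℝ} (hconc : ConcaveOn ℝ orthant f)
    (hmono : MonotoneOn f orthant) {y₁ y₂ : ℝ} (h₁ : 0 ≤ y₁) (h₂ : 0 ≤ y₂) :
    ConcaveOn ℝ (Set.Ici 0) (fun t => f (t, y₁, y₂)) ∧
      MonotoneOn (fun t => f (t, y₁, y₂)) (Set.Ici 0) := by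
  refine ⟨⟨convex_Ici 0, fun u hu w hw s t hs ht hst => ?_⟩, fun u hu w hw huw => ?_⟩
  · have := hconc.2 (x := (u, y₁, y₂)) ⟨hu, h₁, h₂⟩ (y := (w, y₁, y₂)) ⟨hw, h₁, h₂⟩ hs ht hst
    simpa only [Prod.smul_mk, Prod.mk_add_mk, smul_eq_mul, ← add_mul, hst, one_mul] using this
  · exact hmono (a := (u, y₁, y₂)) ⟨hu, h₁, h₂⟩ (b := (w, y₁, y₂)) ⟨hw, h₁, h₂⟩
      ⟨huw, le_rfl, le_rfl⟩

/-! ### Slope thresholds of a function with integer supergradients -/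

/-- The points `c ≥ 0` to the right of which `f` grows at most linearly with slope `k`. -/
def slopeLeSet (k : ℕ) (f : ℝ → ℝ) : Set ℝ :=
  {c | 0 ≤ c ∧ ∀ u, c ≤ u → f u ≤ f c + k * (u - c)}

/-- The smallest point from which on `f` has slope at most `k`. -/
noncomputable def slopeThreshold (k : ℕ) (f : ℝ → ℝ) : ℝ := sInf (slopeLeSet k f)

lemma bddBelow_slopeLeSet (k : ℕ) (f : ℝ → ℝ) : BddBelow (slopeLeSet k f) := ⟨0, fun _ h => h.1⟩

lemma slopeThreshold_nonneg (k : ℕ) (f : ℝ → ℝ) : 0 ≤ slopeThreshold k f :=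
  Real.sInf_nonneg fun _ h => h.1

lemma slopeLeSet_mono {k l : ℕ} (hkl : k ≤ l) (f : ℝ → ℝ) : slopeLeSet k f ⊆ slopeLeSet l f := by
  refine fun c hc => ⟨hc.1, fun u hu => (hc.2 u hu).trans ?_⟩
  have : (k : ℝ) ≤ l := by exact_mod_cast hkl
  have := mul_le_mul_of_nonneg_right this (sub_nonneg.2 hu)
  linarith

lemma isClosed_slopeLeSet (k : ℕ) {f : ℝ → ℝ} (hf : Continuous f) :
    IsClosed (slopeLeSet k f) := by
  have : slopeLeSet k f = Set.Ici 0 ∩ ⋂ d : Set.Ici (0 : ℝ),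
      {c | f (c + d) ≤ f c + k * d} := by
    ext c
    simp only [slopeLeSet, Set.mem_ofPred_eq, Set.mem_inter_iff, Set.mem_Ici, Set.mem_iInter,
      Subtype.forall]
    refine and_congr_right fun _ => ⟨fun h d hd => ?_, fun h u hu => ?_⟩
    · simpa using h (c + d) (by linarith)
    · simpa using h (u - c) (sub_nonneg.2 hu)
  rw [this]
  exact isClosed_Ici.inter (isClosed_iInter fun d =>
    isClosed_le (by fun_prop) (by fun_prop))

namespace HasNatSupergradients

variable {N : ℕ} {f : ℝ → ℝ} {G : ℝ}

lemma mem_slopeLeSet_of_le (hf : HasNatSupergradients N f) {k : ℕ} {c v : ℝ}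
    (hc : c ∈ slopeLeSet k f) (hcv : c ≤ v) : v ∈ slopeLeSet k f := by
  rcases hcv.eq_or_lt with rfl | hlt
  · exact hc
  have hv0 : 0 ≤ v := hc.1.trans hcv
  obtain ⟨m, -, hm⟩ := hf v hv0
  -- a supergradient at `v` cannot exceed the slope over `[c, v]`
  have hmk : (m : ℝ) ≤ k := by
    have h1 := hm c hc.1
    have h2 := hc.2 v hcv
    by_contra hcon
    have := mul_lt_mul_of_pos_right (not_le.1 hcon) (sub_pos.2 hlt)
    linarith
  refine ⟨hv0, fun u hu => (hm u (hv0.trans hu)).trans ?_⟩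
  have := mul_le_mul_of_nonneg_right hmk (sub_nonneg.2 hu)
  linarith

lemma mem_slopeLeSet_of_lt (hf : HasNatSupergradients N f) (h0 : 0 ≤ f 0)
    (hG : ∀ u, 0 ≤ u → f u ≤ G) {c : ℝ} (hc : G < c) : c ∈ slopeLeSet 0 f := by
  have hc0 : 0 < c := (h0.trans (hG 0 le_rfl)).trans_lt hc
  obtain ⟨m, -, hm⟩ := hf c hc0.le
  have hm0 : m = 0 := by
    by_contra hne
    have h1 : (1 : ℝ) ≤ m := by exact_mod_cast Nat.one_le_iff_ne_zero.2 hne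
    have h2 := hm 0 le_rfl
    have h3 := hG c hc0.le
    have := mul_le_mul_of_nonneg_right h1 hc0.le
    linarith
  subst hm0
  exact ⟨hc0.le, fun u hu => hm u (hc0.le.trans hu)⟩

lemma slopeThreshold_le_iff (hf : HasNatSupergradients N f) (hcont : Continuous f)
    (h0 : 0 ≤ f 0) (hG : ∀ u, 0 ≤ u → f u ≤ G) {k : ℕ} {c : ℝ} :
    slopeThreshold k f ≤ c ↔ c ∈ slopeLeSet k f := by
  refine ⟨fun h => ?_, fun h => csInf_le (bddBelow_slopeLeSet k f) h⟩
  have hne : (slopeLeSet k f).Nonempty :=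
    ⟨G + 1, slopeLeSet_mono (Nat.zero_le k) f (hf.mem_slopeLeSet_of_lt h0 hG (lt_add_one G))⟩
  exact hf.mem_slopeLeSet_of_le
    ((isClosed_slopeLeSet k hcont).csInf_mem hne (bddBelow_slopeLeSet k f)) h

/-- Since slopes are integers, slope at least `1` over `[0, c]` forces `c ≤ f c`. -/
lemma slopeThreshold_le (hf : HasNatSupergradients N f) (h0 : 0 ≤ f 0)
    (hG : ∀ u, 0 ≤ u → f u ≤ G) (k : ℕ) : slopeThreshold k f ≤ G :=
  le_of_forall_gt_imp_ge_of_dense fun _ hc => csInf_le (bddBelow_slopeLeSet k f)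
    (slopeLeSet_mono (Nat.zero_le k) f (hf.mem_slopeLeSet_of_lt h0 hG hc))

lemma slopeThreshold_self (hf : HasNatSupergradients N f) : slopeThreshold N f = 0 := by
  refine le_antisymm (csInf_le (bddBelow_slopeLeSet N f) ?_) (slopeThreshold_nonneg N f)
  obtain ⟨m, hm, h⟩ := hf 0 le_rfl
  exact slopeLeSet_mono hm f ⟨le_rfl, fun u hu => h u hu⟩

lemma slopeThreshold_succ_le (hf : HasNatSupergradients N f) (hcont : Continuous f)
    (h0 : 0 ≤ f 0) (hG : ∀ u, 0 ≤ u → f u ≤ G) (k : ℕ) :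
    slopeThreshold (k + 1) f ≤ slopeThreshold k f :=
  (hf.slopeThreshold_le_iff hcont h0 hG).2
    (slopeLeSet_mono k.le_succ f ((hf.slopeThreshold_le_iff hcont h0 hG).1 le_rfl))

lemma le_of_slopeThreshold_zero_le (hf : HasNatSupergradients N f) (hcont : Continuous f)
    (h0 : 0 ≤ f 0) (hG : ∀ u, 0 ≤ u → f u ≤ G) {v : ℝ} (hv : slopeThreshold 0 f ≤ v) {u : ℝ}
    (hu : 0 ≤ u) : f u ≤ f v + (0 : ℕ) * (u - v) := by
  have hmem := (hf.slopeThreshold_le_iff hcont h0 hG).1 hv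
  rcases le_total v u with h | h
  · exact hmem.2 u h
  · obtain ⟨m, -, hm⟩ := hf v hmem.1
    have := mul_nonneg (Nat.cast_nonneg m : (0 : ℝ) ≤ m) (sub_nonneg.2 h)
    have := hm u hu
    push_cast
    linarith

/-- Between two consecutive thresholds, `k + 1` is a supergradient. -/
lemma le_of_slopeThreshold_succ_le (hf : HasNatSupergradients N f) (hcont : Continuous f)
    (h0 : 0 ≤ f 0) (hG : ∀ u, 0 ≤ u → f u ≤ G) {k : ℕ} {v : ℝ}
    (hv : slopeThreshold (k + 1) f ≤ v) (hv' : v ≤ slopeThreshold k f) {u : ℝ} (hu : 0 ≤ u) :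
    f u ≤ f v + (k + 1 : ℕ) * (u - v) := by
  rcases le_or_gt v u with h | h
  · exact ((hf.slopeThreshold_le_iff hcont h0 hG).1 hv).2 u h
  have hlim : Tendsto (fun c => f c + (k + 1 : ℕ) * (u - c)) (𝓝[<] v)
      (𝓝 (f v + (k + 1 : ℕ) * (u - v))) :=
    ((by fun_prop : Continuous fun c => f c + (k + 1 : ℕ) * (u - c)).tendsto v).mono_left
      nhdsWithin_le_nhds
  refine ge_of_tendsto hlim ?_
  filter_upwards [Ioo_mem_nhdsLT h] with c hc
  have hc0 : 0 ≤ c := hu.trans hc.1.le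
  obtain ⟨m, -, hm⟩ := hf c hc0
  -- `c` lies strictly below the threshold for slope `k`, so its supergradient exceeds `k`
  have hkm : k + 1 ≤ m := by
    by_contra hcon
    have hmem : c ∈ slopeLeSet k f := slopeLeSet_mono (show m ≤ k by omega) f
      ⟨hc0, fun w hw => hm w (hc0.trans hw)⟩
    have := (hf.slopeThreshold_le_iff hcont h0 hG).2 hmem
    linarith [hc.2]
  have h1 : ((k + 1 : ℕ) : ℝ) ≤ m := by exact_mod_cast hkm
  have h2 := mul_le_mul_of_nonneg_right h1 (sub_nonneg.2 hc.1.le)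
  have h3 := hm u hu
  linarith

end HasNatSupergradients

/-! ### Propagation of integer supergradients through the recursion -/

/-- The functions `h x = ρ (·, y₁ p₁(x), y₂ p₂(x))` have a common integer supergradient along some
nonnegative `v` of mass `s`: take `k` minimal such that the threshold for slope `k` has mass at
most `s`, and interpolate between the thresholds for the slopes `k` and `k - 1`. By the
Lagrange multiplier principle `v` is then optimal. -/
lemma exists_common_supergradient {N : ℕ} (hL : IsLipschitzCost a l₁ l₂ ρ) (hp₁ : IsDensity μ p₁) (hp₂ : IsDensity μ p₂)
    (hS : ∀ y₁ y₂, 0 ≤ y₁ → 0 ≤ y₂ → HasNatSupergradients N (fun t => ρ (t, y₁, y₂)))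
    (hnonneg : ∀ z ∈ orthant, 0 ≤ ρ z) (hle : ∀ z ∈ orthant, ρ z ≤ stopCost l₁ l₂ z)
    {y₁ y₂ s : ℝ} (hy₁ : 0 ≤ y₁) (hy₂ : 0 ≤ y₂) (hs : 0 ≤ s) :
    ∃ m : ℕ, m ≤ N ∧ ∃ v : X → ℝ, Measurable v ∧ (∀ x, 0 ≤ v x) ∧ Integrable v μ ∧
      ∫ x, v x ∂μ = s ∧ ∀ x u, 0 ≤ u →
        ρ (u, y₁ * p₁ x, y₂ * p₂ x) ≤ ρ (v x, y₁ * p₁ x, y₂ * p₂ x) + m * (u - v x) := by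
  have hm₁ := hp₁.measurable
  have hm₂ := hp₂.measurable
  have hρ := hL.continuous
  set h : X → ℝ → ℝ := fun x t => ρ (t, y₁ * p₁ x, y₂ * p₂ x) with hh
  have hq₁ : ∀ x, 0 ≤ y₁ * p₁ x := fun x => mul_nonneg hy₁ (hp₁.nonneg x)
  have hq₂ : ∀ x, 0 ≤ y₂ * p₂ x := fun x => mul_nonneg hy₂ (hp₂.nonneg x)
  have hhS : ∀ x, HasNatSupergradients N (h x) := fun x => hS _ _ (hq₁ x) (hq₂ x)
  have hhc : ∀ x, Continuous (h x) := fun x => by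
    simp only [hh]
    exact hρ.comp (by fun_prop)
  have hh0 : ∀ x, 0 ≤ h x 0 := fun x => hnonneg _ ⟨le_rfl, hq₁ x, hq₂ x⟩
  have hhG : ∀ x u, 0 ≤ u → h x u ≤ l₁ * (y₁ * p₁ x) := fun x u hu =>
    (hle _ ⟨hu, hq₁ x, hq₂ x⟩).trans (min_le_left _ _)
  set T : ℕ → X → ℝ := fun k x => slopeThreshold k (h x) with hT
  have hT0 : ∀ k x, 0 ≤ T k x := fun k x => slopeThreshold_nonneg k _
  have hTm : ∀ k, Measurable (T k) := by
    intro k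
    refine measurable_of_Iic fun c => ?_
    rcases lt_or_ge c 0 with hc | hc
    · have : T k ⁻¹' Set.Iic c = ∅ := by
        ext x
        simpa using hc.trans_le (hT0 k x)
      rw [this]
      exact MeasurableSet.empty
    · have hclosed : IsClosed {y : ℝ × ℝ | ∀ u, c ≤ u → ρ (u, y) ≤ ρ (c, y) + k * (u - c)} := by
        simp only [Set.ofPred_forall]
        refine isClosed_iInter fun u => isClosed_iInter fun _ => isClosed_le ?_ ?_
        · exact hρ.comp (by fun_prop)
        · exact (hρ.comp (by fun_prop)).add continuous_const
      have : T k ⁻¹' Set.Iic c = (fun x => (y₁ * p₁ x, y₂ * p₂ x)) ⁻¹'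
          {y : ℝ × ℝ | ∀ u, c ≤ u → ρ (u, y) ≤ ρ (c, y) + k * (u - c)} := by
        ext x
        simp only [Set.mem_preimage, Set.mem_Iic, hT,
          (hhS x).slopeThreshold_le_iff (hhc x) (hh0 x) (hhG x)]
        exact and_iff_right hc
      rw [this]
      exact (by fun_prop : Measurable fun x => (y₁ * p₁ x, y₂ * p₂ x)) hclosed.measurableSet
  have hTi : ∀ k, Integrable (T k) μ := fun k =>
    ((hp₁.integrable.const_mul y₁).const_mul l₁).mono' (hTm k).aestronglyMeasurable
      (Eventually.of_forall fun x => by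
        rw [Real.norm_of_nonneg (hT0 k x)]
        exact (hhS x).slopeThreshold_le (hh0 x) (hhG x) k)
  have hTN : ∫ x, T N x ∂μ ≤ s := by
    have : ∀ x, T N x = 0 := fun x => (hhS x).slopeThreshold_self
    simpa [this] using hs
  classical
  have hex : ∃ k, ∫ x, T k x ∂μ ≤ s := ⟨N, hTN⟩
  have hfind := Nat.find_spec hex
  have hmin : ∀ j < Nat.find hex, s < ∫ x, T j x ∂μ := fun j hj => not_le.1 (Nat.find_min hex hj)
  refine ⟨Nat.find hex, Nat.find_min' hex hTN, ?_⟩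
  generalize Nat.find hex = k at hfind hmin
  cases k with
  | zero =>
    set c := s - ∫ x, T 0 x ∂μ with hc
    have hc0 : 0 ≤ c := sub_nonneg.2 hfind
    have hcp : ∀ x, 0 ≤ c * p₁ x := fun x => mul_nonneg hc0 (hp₁.nonneg x)
    refine ⟨fun x => T 0 x + c * p₁ x, (hTm 0).add (hm₁.const_mul c),
      fun x => add_nonneg (hT0 0 x) (hcp x), (hTi 0).add (hp₁.integrable.const_mul c), ?_, ?_⟩
    · rw [integral_add (hTi 0) (hp₁.integrable.const_mul c), integral_const_mul,
        hp₁.integral_eq_one]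
      linarith
    · exact fun x u hu => (hhS x).le_of_slopeThreshold_zero_le (hhc x) (hh0 x) (hhG x)
        (le_add_of_nonneg_right (hcp x)) hu
  | succ j =>
    have hlt := hmin j (Nat.lt_succ_self j)
    set I := ∫ x, T (j + 1) x ∂μ with hI
    set J := ∫ x, T j x ∂μ with hJ
    set θ := (s - I) / (J - I) with hθ
    have hIJ : 0 < J - I := by linarith
    have hθ0 : 0 ≤ θ := div_nonneg (by linarith) hIJ.le
    have hθ1 : θ ≤ 1 := (div_le_one hIJ).2 (by linarith)
    have hTle : ∀ x, 0 ≤ T j x - T (j + 1) x := fun x =>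
      sub_nonneg.2 ((hhS x).slopeThreshold_succ_le (hhc x) (hh0 x) (hhG x) j)
    have hdi : Integrable (fun x => θ * (T j x - T (j + 1) x)) μ :=
      ((hTi j).sub (hTi (j + 1))).const_mul θ
    refine ⟨fun x => T (j + 1) x + θ * (T j x - T (j + 1) x),
      (hTm (j + 1)).add (((hTm j).sub (hTm (j + 1))).const_mul θ),
      fun x => add_nonneg (hT0 _ x) (mul_nonneg hθ0 (hTle x)), (hTi (j + 1)).add hdi, ?_, ?_⟩
    · rw [integral_add (hTi (j + 1)) hdi, integral_const_mul,
        integral_sub (hTi j) (hTi (j + 1)), ← hI, ← hJ, hθ, div_mul_cancel₀ _ hIJ.ne']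
      ring
    · refine fun x u hu => (hhS x).le_of_slopeThreshold_succ_le (hhc x) (hh0 x) (hhG x)
        (le_add_of_nonneg_right (mul_nonneg hθ0 (hTle x))) ?_ hu
      have := mul_le_mul_of_nonneg_right hθ1 (hTle x)
      change T (j + 1) x + θ * (T j x - T (j + 1) x) ≤ T j x
      linarith

lemma hasNatSupergradients_continueCost {N : ℕ} (hL : IsLipschitzCost a l₁ l₂ ρ)
    (hp₁ : IsDensity μ p₁) (hp₂ : IsDensity μ p₂)
    (hS : ∀ y₁ y₂, 0 ≤ y₁ → 0 ≤ y₂ → HasNatSupergradients N (fun t => ρ (t, y₁, y₂)))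
    (hnonneg : ∀ z ∈ orthant, 0 ≤ ρ z) (hle : ∀ z ∈ orthant, ρ z ≤ stopCost l₁ l₂ z)
    {y₁ y₂ : ℝ} (hy₁ : 0 ≤ y₁) (hy₂ : 0 ≤ y₂) :
    HasNatSupergradients N (fun t => continueCost μ p₁ p₂ ρ (t, y₁, y₂)) := by
  intro s hs
  obtain ⟨m, hmN, v, hvm, hv0, hvi, hvs, hsup⟩ :=
    exists_common_supergradient hL hp₁ hp₂ hS hnonneg hle hy₁ hy₂ hs
  refine ⟨m, hmN, fun u hu => continueCost_le hp₁ fun q hq => ?_⟩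
  have hopt := hL.integral_le_continueCost hp₁ hp₂ hvm hv0 hvi y₁ y₂
  rw [hvs] at hopt
  have hρv := hL.integrable_comp hp₁ hp₂ hvm hvi y₁ y₂
  have hqi := hq.integrable.const_mul u
  have hlin : Integrable (fun x => (m : ℝ) * (u * q x - v x)) μ := (hqi.sub hvi).const_mul _
  have hint : ∫ x, (ρ (v x, y₁ * p₁ x, y₂ * p₂ x) + m * (u * q x - v x)) ∂μ =
      ∫ x, ρ (v x, y₁ * p₁ x, y₂ * p₂ x) ∂μ + m * (u - s) := by
    rw [integral_add hρv hlin, integral_const_mul, integral_sub hqi hvi, integral_const_mul,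
      hq.integral_eq_one, hvs, mul_one]
  calc expectedCost μ p₁ p₂ ρ (u, y₁, y₂) q
      ≤ ∫ x, (ρ (v x, y₁ * p₁ x, y₂ * p₂ x) + m * (u * q x - v x)) ∂μ :=
        integral_mono (hL.integrable hp₁ hp₂ hq (u, y₁, y₂)) (hρv.add hlin)
          fun x => hsup x _ (mul_nonneg hu (hq.nonneg x))
    _ ≤ continueCost μ p₁ p₂ ρ (s, y₁, y₂) + m * (u - s) := by rw [hint]; linarith

lemma hasNatSupergradients_rhoN (hp₁ : IsDensity μ p₁) (hp₂ : IsDensity μ p₂) (hl₁ : 0 ≤ l₁)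
    (hl₂ : 0 ≤ l₂) (n : ℕ) {y₁ y₂ : ℝ} (hy₁ : 0 ≤ y₁) (hy₂ : 0 ≤ y₂) :
    HasNatSupergradients n (fun t => rhoN μ p₁ p₂ l₁ l₂ n (t, y₁, y₂)) := by
  induction n generalizing y₁ y₂ with
  | zero => exact fun s _ => ⟨0, le_rfl, fun u _ => by simp [rhoN, stopCost]⟩
  | succ n ih =>
    intro s hs
    obtain ⟨m, hmn, hm⟩ := hasNatSupergradients_continueCost
      (isLipschitzCost_rhoN hp₁ hp₂ hl₁ hl₂ n) hp₁ hp₂ (fun _ _ => ih)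
      (fun _ hz => rhoN_nonneg hp₁ hp₂ hl₁ hl₂ n hz) (fun z _ => rhoN_le_stopCost n z)
      hy₁ hy₂ s hs
    simp only [rhoN]
    rcases min_choice (stopCost l₁ l₂ (s, y₁, y₂))
      (s + continueCost μ p₁ p₂ (rhoN μ p₁ p₂ l₁ l₂ n) (s, y₁, y₂)) with h | h <;> rw [h]
    · exact ⟨0, Nat.zero_le _, fun u _ => (min_le_left _ _).trans (by simp [stopCost])⟩
    · refine ⟨m + 1, Nat.succ_le_succ hmn, fun u hu => (min_le_right _ _).trans ?_⟩
      have := hm u hu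
      push_cast
      linarith

/-! ### Vanishing of the limit cost at `z₀ = 0` -/

lemma IsDensity.integrable_sqrt_mul (hp₁ : IsDensity μ p₁) (hp₂ : IsDensity μ p₂) :
    Integrable (fun x => √(p₁ x * p₂ x)) μ := by
  have hm₁ := hp₁.measurable
  have hm₂ := hp₂.measurable
  refine (hp₁.integrable.add hp₂.integrable).mono' (by fun_prop)
    (Eventually.of_forall fun x => ?_)
  rw [Real.norm_of_nonneg (Real.sqrt_nonneg _)]
  have h₁ := hp₁.nonneg x
  have h₂ := hp₂.nonneg x
  refine (Real.sqrt_le_left (add_nonneg h₁ h₂)).2 ?_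
  nlinarith

/-- The Bhattacharyya coefficient of two distinct distributions is less than `1`, because
`∫ (√p₁ - √p₂)² = 2 - 2 ∫ √(p₁ p₂)`. -/
lemma IsDensity.integral_sqrt_mul_lt_one (hp₁ : IsDensity μ p₁) (hp₂ : IsDensity μ p₂)
    (hne : densityMeasure μ p₁ ≠ densityMeasure μ p₂) : ∫ x, √(p₁ x * p₂ x) ∂μ < 1 := by
  have hi := hp₁.integrable_sqrt_mul hp₂
  have h12 : Integrable (fun x => p₁ x + p₂ x) μ := hp₁.integrable.add hp₂.integrable
  have hsq : ∀ x, (√(p₁ x) - √(p₂ x)) ^ 2 = p₁ x + p₂ x - 2 * √(p₁ x * p₂ x) := fun x => by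
    rw [Real.sqrt_mul (hp₁.nonneg x), sub_sq, Real.sq_sqrt (hp₁.nonneg x),
      Real.sq_sqrt (hp₂.nonneg x)]
    ring
  have hint : ∫ x, (√(p₁ x) - √(p₂ x)) ^ 2 ∂μ = 2 - 2 * ∫ x, √(p₁ x * p₂ x) ∂μ := by
    simp only [hsq]
    rw [integral_sub h12 (hi.const_mul 2),
      integral_add hp₁.integrable hp₂.integrable, integral_const_mul, hp₁.integral_eq_one,
      hp₂.integral_eq_one]
    norm_num
  have hsqi : Integrable (fun x => (√(p₁ x) - √(p₂ x)) ^ 2) μ := by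
    simp only [hsq]
    exact h12.sub (hi.const_mul 2)
  have hnn : 0 ≤ ∫ x, (√(p₁ x) - √(p₂ x)) ^ 2 ∂μ := integral_nonneg fun x => sq_nonneg _
  by_contra hcon
  have h0 : ∫ x, (√(p₁ x) - √(p₂ x)) ^ 2 ∂μ = 0 := by linarith [not_lt.1 hcon]
  refine hne (withDensity_congr_ae ?_)
  filter_upwards [(integral_eq_zero_iff_of_nonneg (fun x => sq_nonneg _) hsqi).1 h0] with x hx
  have : √(p₁ x) - √(p₂ x) = 0 := by simpa using hx
  rw [(Real.sqrt_inj (hp₁.nonneg x) (hp₂.nonneg x)).1 (sub_eq_zero.1 this)]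

lemma min_le_sqrt_mul {b c : ℝ} (hb : 0 ≤ b) (hc : 0 ≤ c) : min b c ≤ √(b * c) := by
  refine Real.le_sqrt_of_sq_le ?_
  rw [sq]
  exact mul_le_mul (min_le_left _ _) (min_le_right _ _) (le_min hb hc) hb

lemma rhoN_zero_le (hp₁ : IsDensity μ p₁) (hp₂ : IsDensity μ p₂) (hl₁ : 0 ≤ l₁) (hl₂ : 0 ≤ l₂)
    (n : ℕ) {y₁ y₂ : ℝ} (hy₁ : 0 ≤ y₁) (hy₂ : 0 ≤ y₂) :
    rhoN μ p₁ p₂ l₁ l₂ n (0, y₁, y₂) ≤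
      √(l₁ * l₂) * √(y₁ * y₂) * (∫ x, √(p₁ x * p₂ x) ∂μ) ^ n := by
  induction n generalizing y₁ y₂ with
  | zero =>
    refine (min_le_sqrt_mul (mul_nonneg hl₁ hy₁) (mul_nonneg hl₂ hy₂)).trans (le_of_eq ?_)
    rw [mul_mul_mul_comm, Real.sqrt_mul (mul_nonneg hl₁ hl₂), pow_zero, mul_one]
  | succ n ih =>
    have hL := isLipschitzCost_rhoN hp₁ hp₂ hl₁ hl₂ n
    refine (min_le_right _ _).trans ?_
    rw [zero_add]
    refine continueCost_le hp₁ fun p₀ hp₀ => ?_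
    rw [pow_succ, ← mul_assoc, ← integral_const_mul]
    refine integral_mono (hL.integrable hp₁ hp₂ hp₀ (0, y₁, y₂))
      ((hp₁.integrable_sqrt_mul hp₂).const_mul _) fun x => ?_
    have := ih (mul_nonneg hy₁ (hp₁.nonneg x)) (mul_nonneg hy₂ (hp₂.nonneg x))
    rw [mul_mul_mul_comm y₁, Real.sqrt_mul (mul_nonneg hy₁ hy₂)] at this
    simp only [zero_mul]
    refine this.trans (le_of_eq ?_)
    ring

lemma rhoLim_zero (hp₁ : IsDensity μ p₁) (hp₂ : IsDensity μ p₂)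
    (hne : densityMeasure μ p₁ ≠ densityMeasure μ p₂) (hl₁ : 0 ≤ l₁) (hl₂ : 0 ≤ l₂)
    {y₁ y₂ : ℝ} (hy₁ : 0 ≤ y₁) (hy₂ : 0 ≤ y₂) : rhoLim μ p₁ p₂ l₁ l₂ (0, y₁, y₂) = 0 := by
  have hz : ((0 : ℝ), y₁, y₂) ∈ orthant := ⟨le_rfl, hy₁, hy₂⟩
  have hpow : Tendsto (fun n : ℕ => √(l₁ * l₂) * √(y₁ * y₂) * (∫ x, √(p₁ x * p₂ x) ∂μ) ^ n)
      atTop (𝓝 0) := by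
    simpa using (tendsto_pow_atTop_nhds_zero_of_lt_one
      (integral_nonneg fun x => Real.sqrt_nonneg _)
      (hp₁.integral_sqrt_mul_lt_one hp₂ hne)).const_mul (√(l₁ * l₂) * √(y₁ * y₂))
  exact tendsto_nhds_unique (tendsto_rhoN hp₁ hp₂ hl₁ hl₂ hz)
    (squeeze_zero (fun n => rhoN_nonneg hp₁ hp₂ hl₁ hl₂ n hz)
      (fun n => rhoN_zero_le hp₁ hp₂ hl₁ hl₂ n hy₁ hy₂) hpow)

/-! ### Growth of the costs at `z₀ = 0` for distributions that are not mutually singular -/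

lemma IsDensity.integrable_min (hp₁ : IsDensity μ p₁) (hp₂ : IsDensity μ p₂) :
    Integrable (fun x => min (p₁ x) (p₂ x)) μ := hp₁.integrable.inf hp₂.integrable

lemma IsDensity.integral_min_pos (hp₁ : IsDensity μ p₁) (hp₂ : IsDensity μ p₂)
    (hns : ¬ (densityMeasure μ p₁ ⟂ₘ densityMeasure μ p₂)) :
    0 < ∫ x, min (p₁ x) (p₂ x) ∂μ := by
  have hnn : ∀ x, 0 ≤ min (p₁ x) (p₂ x) := fun x => le_min (hp₁.nonneg x) (hp₂.nonneg x)
  refine (integral_nonneg hnn).lt_of_ne fun h0 => hns ?_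
  have hae := (integral_eq_zero_iff_of_nonneg hnn (hp₁.integrable_min hp₂)).1 h0.symm
  have hS : MeasurableSet {x | p₁ x = 0} := hp₁.measurable (measurableSet_singleton 0)
  refine ⟨{x | p₁ x = 0}, hS, ?_, ?_⟩
  · rw [densityMeasure, withDensity_apply _ hS, setLIntegral_congr_fun (g := 0) hS]
    · simp
    · intro x hx
      simp [show p₁ x = 0 from hx]
  · rw [densityMeasure, withDensity_apply _ hS.compl,
      setLIntegral_congr_fun_ae (g := 0) hS.compl]
    · simp
    · filter_upwards [hae] with x hx hxS
      have h1 : 0 < p₁ x := lt_of_le_of_ne (hp₁.nonneg x) (Ne.symm hxS)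
      have h2 : p₂ x ≤ 0 := by
        rcases min_le_iff.1 (le_of_eq hx) with h | h
        · exact absurd h (not_le.2 h1)
        · exact h
      simp [h2]

/-- Uniformly in the horizon, the cost grows near `z₀ = 0` faster than `k z₀`, for each `k`. Each
step of the recursion adds `z₀` to the lower bound, as long as the choice `p₀ = min {p₁, p₂} / α`
keeps `z₀ p₀` below the multiples of `z₁ p₁` and `z₂ p₂` where the bound is linear. -/
lemma exists_mul_min_le_rhoN (hp₁ : IsDensity μ p₁) (hp₂ : IsDensity μ p₂) (hl₁ : 0 < l₁)
    (hl₂ : 0 < l₂) (hns : ¬ (densityMeasure μ p₁ ⟂ₘ densityMeasure μ p₂)) (k : ℕ) :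
    ∃ δ : ℝ, 0 < δ ∧ ∀ (n : ℕ), ∀ z ∈ orthant,
      k * min z.1 (min (δ * z.2.1) (δ * z.2.2)) ≤ rhoN μ p₁ p₂ l₁ l₂ n z := by
  induction k with
  | zero =>
    exact ⟨1, one_pos, fun n z hz => by
      simpa using rhoN_nonneg hp₁ hp₂ hl₁.le hl₂.le n hz⟩
  | succ k ih =>
    obtain ⟨δ, hδ, ih⟩ := ih
    set α := ∫ x, min (p₁ x) (p₂ x) ∂μ with hα
    have hα0 : 0 < α := hp₁.integral_min_pos hp₂ hns
    have hp₀ : IsDensity μ (fun x => α⁻¹ * min (p₁ x) (p₂ x)) :=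
      ⟨(hp₁.measurable.min hp₂.measurable).const_mul _,
        fun x => mul_nonneg (inv_nonneg.2 hα0.le) (le_min (hp₁.nonneg x) (hp₂.nonneg x)),
        (hp₁.integrable_min hp₂).const_mul _, by
          rw [integral_const_mul, ← hα, inv_mul_cancel₀ hα0.ne']⟩
    have hk : (0 : ℝ) < k + 1 := by positivity
    set δ' := min (δ * α) (min l₁ l₂ / (k + 1)) with hδ'
    have hδ'0 : 0 < δ' := lt_min (mul_pos hδ hα0) (div_pos (lt_min hl₁ hl₂) hk)
    have hδα : δ' ≤ δ * α := min_le_left _ _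
    have hδl : (k + 1) * δ' ≤ min l₁ l₂ := (le_div_iff₀' hk).1 (min_le_right _ _)
    have hcost : ∀ z ∈ orthant,
        (k + 1) * min z.1 (min (δ' * z.2.1) (δ' * z.2.2)) ≤ stopCost l₁ l₂ z := by
      intro z hz
      have h1 := mul_le_mul_of_nonneg_right (hδl.trans (min_le_left _ _)) hz.2.1
      have h2 := mul_le_mul_of_nonneg_right (hδl.trans (min_le_right _ _)) hz.2.2
      refine le_min (le_trans ?_ h1) (le_trans ?_ h2) <;> rw [mul_assoc] <;>
        refine mul_le_mul_of_nonneg_left ?_ hk.le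
      · exact (min_le_right _ _).trans (min_le_left _ _)
      · exact (min_le_right _ _).trans (min_le_right _ _)
    refine ⟨δ', hδ'0, fun n z hz => ?_⟩
    rw [Nat.cast_succ]
    cases n with
    | zero => exact hcost z hz
    | succ n =>
      refine le_min (hcost z hz) ?_
      set t := min z.1 (min (δ' * z.2.1) (δ' * z.2.2)) with ht
      have ht0 : 0 ≤ t := le_min hz.1
        (le_min (mul_nonneg hδ'0.le hz.2.1) (mul_nonneg hδ'0.le hz.2.2))
      have htz : t ≤ z.1 := min_le_left _ _
      have ht₁ : t ≤ δ * α * z.2.1 := ((min_le_right _ _).trans (min_le_left _ _)).trans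
        (mul_le_mul_of_nonneg_right hδα hz.2.1)
      have ht₂ : t ≤ δ * α * z.2.2 := ((min_le_right _ _).trans (min_le_right _ _)).trans
        (mul_le_mul_of_nonneg_right hδα hz.2.2)
      have hL := isLipschitzCost_rhoN hp₁ hp₂ hl₁.le hl₂.le n
      have hw : (t, z.2.1, z.2.2) ∈ orthant := ⟨ht0, hz.2.1, hz.2.2⟩
      have h1 := monotoneOn_continueCost hL hp₁ hp₂
        (monotoneOn_concaveOn_rhoN hp₁ hp₂ hl₁.le hl₂.le n).1 hw hz ⟨htz, le_rfl, le_rfl⟩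
      have h2 := hL.le_continueCost hp₁ hp₂ hp₀ (t, z.2.1, z.2.2)
      have h3 : k * t ≤ expectedCost μ p₁ p₂ (rhoN μ p₁ p₂ l₁ l₂ n) (t, z.2.1, z.2.2)
          (fun x => α⁻¹ * min (p₁ x) (p₂ x)) := by
        have e : ∫ x, k * (t * (α⁻¹ * min (p₁ x) (p₂ x))) ∂μ = k * t := by
          rw [integral_const_mul, integral_const_mul, hp₀.integral_eq_one, mul_one]
        rw [← e]
        refine integral_mono ((hp₀.integrable.const_mul t).const_mul (k : ℝ))
          (hL.integrable hp₁ hp₂ hp₀ (t, z.2.1, z.2.2)) fun x => ?_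
        refine le_trans (mul_le_mul_of_nonneg_left ?_ (Nat.cast_nonneg k))
          (ih n _ (hp₀.mem_orthant hp₁ hp₂ hw x))
        -- a density value `c` above `min (p₁ x) (p₂ x)` dominates `t p₀(x)`
        have hbound : ∀ y c : ℝ, 0 ≤ y → min (p₁ x) (p₂ x) ≤ c → t ≤ δ * α * y →
            t * (α⁻¹ * min (p₁ x) (p₂ x)) ≤ δ * (y * c) := by
          intro y c hy hc hty
          have hmn : 0 ≤ min (p₁ x) (p₂ x) := le_min (hp₁.nonneg x) (hp₂.nonneg x)
          calc t * (α⁻¹ * min (p₁ x) (p₂ x))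
              ≤ δ * α * y * (α⁻¹ * min (p₁ x) (p₂ x)) :=
                mul_le_mul_of_nonneg_right hty (mul_nonneg (inv_nonneg.2 hα0.le) hmn)
            _ = δ * y * min (p₁ x) (p₂ x) := by field_simp
            _ ≤ δ * y * c := mul_le_mul_of_nonneg_left hc (mul_nonneg hδ.le hy)
            _ = δ * (y * c) := mul_assoc _ _ _
        exact le_min le_rfl (le_min (hbound _ _ hz.2.1 (min_le_left _ _) ht₁)
          (hbound _ _ hz.2.2 (min_le_right _ _) ht₂))
      linarith

lemma hasRightDeriv_rhoLim_zero (hp₁ : IsDensity μ p₁) (hp₂ : IsDensity μ p₂)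
    (hne : densityMeasure μ p₁ ≠ densityMeasure μ p₂) (hl₁ : 0 < l₁) (hl₂ : 0 < l₂)
    (hns : ¬ (densityMeasure μ p₁ ⟂ₘ densityMeasure μ p₂)) {y₁ y₂ : ℝ} (hy₁ : 0 ≤ y₁)
    (hy₂ : 0 ≤ y₂) :
    HasRightDeriv (fun t => rhoLim μ p₁ p₂ l₁ l₂ (t, y₁, y₂)) 0 0 ∨
      HasRightDeriv (fun t => rhoLim μ p₁ p₂ l₁ l₂ (t, y₁, y₂)) ⊤ 0 := by
  have hzero := rhoLim_zero hp₁ hp₂ hne hl₁.le hl₂.le hy₁ hy₂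
  by_cases hy : 0 < y₁ ∧ 0 < y₂
  · right
    rw [HasRightDeriv, EReal.tendsto_nhds_top_iff_real]
    intro r
    obtain ⟨k, hk⟩ := exists_nat_gt r
    obtain ⟨δ, hδ, hb⟩ := exists_mul_min_le_rhoN hp₁ hp₂ hl₁ hl₂ hns k
    have hpos : 0 < min (δ * y₁) (δ * y₂) := lt_min (mul_pos hδ hy.1) (mul_pos hδ hy.2)
    filter_upwards [Ioo_mem_nhdsGT hpos] with t ht
    have hz : (t, y₁, y₂) ∈ orthant := ⟨ht.1.le, hy₁, hy₂⟩
    have hkt : k * t ≤ rhoLim μ p₁ p₂ l₁ l₂ (t, y₁, y₂) :=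
      ge_of_tendsto' (tendsto_rhoN hp₁ hp₂ hl₁.le hl₂.le hz) fun n => by
        simpa [min_eq_left ht.2.le] using hb n _ hz
    rw [hzero, sub_zero, sub_zero, EReal.coe_lt_coe_iff, lt_div_iff₀ ht.1]
    exact (mul_lt_mul_of_pos_right hk ht.1).trans_le hkt
  · left
    have hconst : ∀ t, 0 < t → rhoLim μ p₁ p₂ l₁ l₂ (t, y₁, y₂) = 0 := by
      intro t ht
      have hz : (t, y₁, y₂) ∈ orthant := ⟨ht.le, hy₁, hy₂⟩
      have hcost : stopCost l₁ l₂ (t, y₁, y₂) ≤ 0 := by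
        rcases not_and_or.1 hy with h | h
        · have : y₁ = 0 := le_antisymm (not_lt.1 h) hy₁
          exact (min_le_left _ _).trans (by simp [this])
        · have : y₂ = 0 := le_antisymm (not_lt.1 h) hy₂
          exact (min_le_right _ _).trans (by simp [this])
      have hlim := tendsto_rhoN hp₁ hp₂ hl₁.le hl₂.le hz
      exact le_antisymm (le_of_tendsto' hlim fun n => (rhoN_le_stopCost n _).trans hcost)
        (ge_of_tendsto' hlim fun n => rhoN_nonneg hp₁ hp₂ hl₁.le hl₂.le n hz)
    refine tendsto_const_nhds.congr' ?_
    filter_upwards [self_mem_nhdsWithin] with t ht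
    simp [hconst t ht, hzero]

end

/-! ### Structure of the cost functions -/

theorem theorem2 {X : Type*} [MeasurableSpace X] (μ : Measure X)
    (p₁ p₂ : X → ℝ) (hp₁ : IsDensity μ p₁) (hp₂ : IsDensity μ p₂)
    (hne : densityMeasure μ p₁ ≠ densityMeasure μ p₂)
    (l₁ l₂ : ℝ) (hl₁ : 0 < l₁) (hl₂ : 0 < l₂) :
    -- the integrals, suprema and the limit in the definitions are well defined
    (∀ (n : ℕ), ∀ z ∈ orthant,
      (∀ p₀ : X → ℝ, IsDensity μ p₀ →
        Integrable
          (fun x => rhoN μ p₁ p₂ l₁ l₂ n (z.1 * p₀ x, z.2.1 * p₁ x, z.2.2 * p₂ x)) μ) ∧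
      BddAbove (expectedCost μ p₁ p₂ (rhoN μ p₁ p₂ l₁ l₂ n) z '' {p₀ | IsDensity μ p₀})) ∧
    (∀ z ∈ orthant,
      Tendsto (fun n : ℕ => rhoN μ p₁ p₂ l₁ l₂ n z) atTop (𝓝 (rhoLim μ p₁ p₂ l₁ l₂ z))) ∧
    -- monotonicity and concavity
    (∀ n : ℕ, MonotoneOn (rhoN μ p₁ p₂ l₁ l₂ n) orthant ∧
      ConcaveOn ℝ orthant (rhoN μ p₁ p₂ l₁ l₂ n)) ∧
    MonotoneOn (rhoLim μ p₁ p₂ l₁ l₂) orthant ∧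
    ConcaveOn ℝ orthant (rhoLim μ p₁ p₂ l₁ l₂) ∧
    -- right derivatives with respect to `z₀`
    (∀ (n : ℕ) (z₀ z₁ z₂ : ℝ), 0 ≤ z₀ → 0 ≤ z₁ → 0 ≤ z₂ →
      ∃ k : ℕ, k ≤ n ∧
        HasRightDeriv (fun t => rhoN μ p₁ p₂ l₁ l₂ n (t, z₁, z₂)) (k : EReal) z₀) ∧
    (∀ (z₀ z₁ z₂ : ℝ), 0 ≤ z₀ → 0 ≤ z₁ → 0 ≤ z₂ →
      (∃ k : ℕ, HasRightDeriv (fun t => rhoLim μ p₁ p₂ l₁ l₂ (t, z₁, z₂)) (k : EReal) z₀) ∨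
        HasRightDeriv (fun t => rhoLim μ p₁ p₂ l₁ l₂ (t, z₁, z₂)) ⊤ z₀) ∧
    -- behaviour at `z₀ = 0`
    (∀ (z₁ z₂ : ℝ), 0 ≤ z₁ → 0 ≤ z₂ → rhoLim μ p₁ p₂ l₁ l₂ (0, z₁, z₂) = 0) ∧
    (¬ (densityMeasure μ p₁ ⟂ₘ densityMeasure μ p₂) →
      ∀ (z₁ z₂ : ℝ), 0 ≤ z₁ → 0 ≤ z₂ →
        HasRightDeriv (fun t => rhoLim μ p₁ p₂ l₁ l₂ (t, z₁, z₂)) 0 0 ∨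
          HasRightDeriv (fun t => rhoLim μ p₁ p₂ l₁ l₂ (t, z₁, z₂)) ⊤ 0) := by
  have h₁ := hl₁.le
  have h₂ := hl₂.le
  refine ⟨fun n z _ => ?_, fun z hz => tendsto_rhoN hp₁ hp₂ h₁ h₂ hz,
    fun n => monotoneOn_concaveOn_rhoN hp₁ hp₂ h₁ h₂ n, monotoneOn_rhoLim hp₁ hp₂ h₁ h₂,
    concaveOn_rhoLim hp₁ hp₂ h₁ h₂, fun n z₀ z₁ z₂ hz₀ hz₁ hz₂ => ?_,
    fun z₀ z₁ z₂ hz₀ hz₁ hz₂ => ?_, fun z₁ z₂ hz₁ hz₂ => rhoLim_zero hp₁ hp₂ hne h₁ h₂ hz₁ hz₂,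
    fun hns z₁ z₂ hz₁ hz₂ => hasRightDeriv_rhoLim_zero hp₁ hp₂ hne hl₁ hl₂ hns hz₁ hz₂⟩
  · have hL := isLipschitzCost_rhoN hp₁ hp₂ h₁ h₂ n
    exact ⟨fun _ hp₀ => hL.integrable hp₁ hp₂ hp₀ z, hL.bddAbove hp₁ hp₂ z⟩
  · obtain ⟨hmono, hconc⟩ := monotoneOn_concaveOn_rhoN hp₁ hp₂ h₁ h₂ n
    obtain ⟨hconc', hmono'⟩ := concaveOn_monotoneOn_section hconc hmono hz₁ hz₂
    exact (hasNatSupergradients_rhoN hp₁ hp₂ h₁ h₂ n hz₁ hz₂).exists_hasRightDeriv hconc' hmono'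
      hz₀
  · obtain ⟨hconc, hmono⟩ := concaveOn_monotoneOn_section (concaveOn_rhoLim hp₁ hp₂ h₁ h₂)
      (monotoneOn_rhoLim hp₁ hp₂ h₁ h₂) hz₁ hz₂
    exact rightDeriv_nat_or_top hconc hmono
      (fun s hs => tendsto_rhoN hp₁ hp₂ h₁ h₂ ⟨hs, hz₁, hz₂⟩)
      (fun n => hasNatSupergradients_rhoN hp₁ hp₂ h₁ h₂ n hz₁ hz₂) hz₀
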